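/- All vector spaces are real. A *$C$-Benyamini space* ($C>1$) is a Banach lattice $X$ that is (isometrically, as a Banach lattice) a closed sublattice of $C(K)$ with the supremum norm, where: (1) $K=(\bigcup_{n}K_n)\cup\{\infty\}$ is the one-point compactification of the topological disjoint union of a sequence of compact Hausdorff spaces $K_n$ (some possibly empty); (2) $x(\infty)=0$ for all $x\in X$; (3) for each $n$ and all $t\ne s$ in $K_n$ there is $x\in X$ with $x(t)\neq x(s)$; (4) if $t\in K_m$, $s\in K_n$ and $\lambda\in\mathbb R$ satisfy $x(t)=\lambda x(s)$ for all $x\in X$, then $\lambda=C^{n-m}$. An *atom* of $X$ is an element $a>0$ such that every $x$ with $0\le x\le a$ is a scalar multiple of $a$; atoms are counted up to scalar multiples. A *lattice norm* is a norm $N$ such that $|x|\le|y|$ implies $N(x)\le N(y)$; it is an *AM-norm* if moreover $N(x\vee y)=\max\{N(x),N(y)\}$ for all $x,y\ge 0$. A *lattice isometry* is a surjective linear isometry that preserves the lattice operations. **Theorem.** Let $(X,\|\cdot\|)$ be a separable $C$-Benyamini space for some $C>1$. Then for every $c>1$ there is an equivalent lattice norm $|||\cdot|||$ on $X$ with $\|\cdot\|\le|||\cdot|||\le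 c^2\|\cdot\|$ such that the identity is the only lattice isometry of $(X,|||\cdot|||)$. If $X$ has at most one atom, then $|||\cdot|||$ can be chosen to be, in addition, an AM-norm. -/

import Mathlib

open TopologicalSpace

universe u v

/-- A Banach lattice `X` is a `C`-Benyamini space if (up to a lattice isometry `J` onto its image) it
is a sublattice of `C(K)`, where `K` is the one-point compactification of the topological disjoint
union of a sequence of compact Hausdorff spaces `K n` (empty pieces are allowed), such that:
every `x ∈ X` vanishes at `∞`; `X` separates the points of each `K n`; and the only proportionality
constants `l` with `x(t) = l * x(s)` for all `x ∈ X`, where `t ∈ K m` and `s ∈ K n`,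
are `l = C ^ (n - m)`. -/
def IsBenyaminiSpace (C : ℝ) (X : Type u) [NormedAddCommGroup X] [NormedSpace ℝ X] [Lattice X] :
    Prop :=
  1 < C ∧
  ∃ (K : ℕ → Type v) (_ : ∀ n, TopologicalSpace (K n)) (_ : ∀ n, CompactSpace (K n))
    (_ : ∀ n, T2Space (K n)) (J : X →ₗᵢ[ℝ] C(OnePoint (Σ n, K n), ℝ)),
    (∀ x y : X, J (x ⊔ y) = J x ⊔ J y) ∧
    (∀ x y : X, J (x ⊓ y) = J x ⊓ J y) ∧
    (∀ x : X, J x OnePoint.infty = 0) ∧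
    (∀ (n : ℕ) (t s : K n), t ≠ s →
      ∃ x : X, J x (OnePoint.some ⟨n, t⟩) ≠ J x (OnePoint.some ⟨n, s⟩)) ∧
    (∀ (m n : ℕ) (t : K m) (s : K n) (l : ℝ),
      (∀ x : X, J x (OnePoint.some ⟨m, t⟩) = l * J x (OnePoint.some ⟨n, s⟩)) →
        l = C ^ ((n : ℤ) - (m : ℤ)))

section RieszSpace

variable {X : Type u} [AddCommGroup X] [Module ℝ X] [Lattice X]

/-- A (positive) atom of a real vector lattice: a nonzero positive element `a` such that every
element of the order interval `[0, a]` is a scalar multiple of `a`. -/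
def IsLatticeAtom (a : X) : Prop :=
  0 < a ∧ ∀ x : X, 0 ≤ x → x ≤ a → ∃ r : ℝ, x = r • a

/-- `N` is a lattice norm on the vector lattice `X`: it is definite and monotone in `|x|`. -/
structure IsLatticeNorm (N : Seminorm ℝ X) : Prop where
  definite : ∀ x : X, N x = 0 → x = 0
  solid : ∀ x y : X, |x| ≤ |y| → N x ≤ N y

/-- An AM-norm: a lattice norm with `N (x ⊔ y) = max (N x) (N y)` for all positive `x`, `y`. -/
structure IsAMNorm (N : Seminorm ℝ X) : Prop extends IsLatticeNorm N where
  sup_eq : ∀ x y : X, 0 ≤ x → 0 ≤ y → N (x ⊔ y) = max (N x) (N y)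

/-- A lattice isometry of `(X, N)`: a surjective linear isometry preserving the lattice
operations. -/
structure IsLatticeIsometry (N : Seminorm ℝ X) (T : X →ₗ[ℝ] X) : Prop where
  surjective : Function.Surjective T
  isometry : ∀ x : X, N (T x) = N x
  map_sup : ∀ x y : X, T (x ⊔ y) = T x ⊔ T y
  map_inf : ∀ x y : X, T (x ⊓ y) = T x ⊓ T y

end RieszSpace

/-- `X` has at most one atom (atoms being counted up to scalar multiples, that is, after
normalization). -/
def HasAtMostOneAtom (X : Type u) [NormedAddCommGroup X] [NormedSpace ℝ X] [Lattice X] : Prop :=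
  ∀ a b : X, IsLatticeAtom a → IsLatticeAtom b → ‖a‖ = 1 → ‖b‖ = 1 → a = b

/-! Keep one evaluation functional from each class of proportional points of `K`, at the lowest
level of the class. This gives a norming family `e i` of pairwise non-proportional lattice
homomorphisms whose ultrafilter limits are zero or `C⁻¹ ^ k • e j`; these properties
(`IsEvaluationSystem`) replace `K` from then on.

Separability gives a countable separating set of indices, which contains every isolated index. Give
these indices distinct weights `ε i > 0` tending to zero, except one isolated index, the base, which
gets zero. The new norm has a term `(1 + ε i) * |e i x|` for each non-isolated `i`, and a term
coupling `i` with the base for each isolated `i`.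

For a lattice isometry `T`, each `e i ∘ T` is a multiple of some `e j`
(`exists_eq_smul_of_map_sup`). Normalizing by dual norms turns `T` into a permutation `φ` of the
indices. A non-isolated `i` is a limit of other normalized evaluations up to the factor `C⁻¹ ^ k /
(1 + ε i)`, and `φ` preserves this factor. As `1 + ε i` lies in `[1, C)`, it follows that `ε (φ i) =
ε i` (`eps_eq_of_not_isolated`), so `φ` fixes `i` if `ε i > 0`. Isolated indices are fixed because
the coupling makes the norm of `2 a + a'`, for unit masses `a` and `a'`, reveal the base and the
weights (`index_eq_of_isolated`). The fixed indices separate points, so `T` is the identity. With at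
most one isolated index there is no coupling and the norm is AM. -/

open Filter Topology

/-- Compactness in ultrafilter form. If every `y` failed somewhere, the failure sets would be
nonempty and directed, hence lie in a common ultrafilter, contradicting `h`. It yields uniform
estimates in the style of Dini's theorem without a topology on `I`. -/
theorem exists_forall_of_forall_ultrafilter {I Y : Type*} {s : Set Y} (P : Y → I → Prop)
    (hs : s.Nonempty)
    (hdir : ∀ y ∈ s, ∀ z ∈ s, ∃ u ∈ s, ∀ i, P y i ∨ P z i → P u i)
    (h : ∀ U : Ultrafilter I, ∃ y ∈ s, ∀ᶠ i in (U : Filter I), P y i) :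
    ∃ y ∈ s, ∀ i, P y i := by
  by_contra! hcon
  have : Nonempty s := hs.to_subtype
  have hne : (⨅ y : s, 𝓟 {i | ¬ P y i}).NeBot := by
    apply iInf_neBot_of_directed'
    · rintro ⟨y, hy⟩ ⟨z, hz⟩
      obtain ⟨u, hu, hu'⟩ := hdir y hy z hz
      refine ⟨⟨u, hu⟩, ?_, ?_⟩
      · simp only [ge_iff_le, le_principal_iff, mem_principal]
        exact fun i hi hp => hi (hu' i (Or.inl hp))
      · simp only [ge_iff_le, le_principal_iff, mem_principal]
        exact fun i hi hp => hi (hu' i (Or.inr hp))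
    · rintro ⟨y, hy⟩
      obtain ⟨i, hi⟩ := hcon y hy
      exact principal_neBot_iff.2 ⟨i, hi⟩
  obtain ⟨y, hy, hU⟩ := h (Ultrafilter.of (⨅ y : s, 𝓟 {i | ¬ P y i}))
  have hle : ((Ultrafilter.of (⨅ y : s, 𝓟 {i | ¬ P y i}) : Ultrafilter I) : Filter I)
      ≤ 𝓟 {i | ¬ P y i} := (Ultrafilter.of_le _).trans (iInf_le _ (⟨y, hy⟩ : s))
  have hU' : ∀ᶠ i in ((Ultrafilter.of (⨅ y : s, 𝓟 {i | ¬ P y i}) : Ultrafilter I) : Filter I),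
      ¬ P y i := le_principal_iff.1 hle
  obtain ⟨i, h1, h2⟩ := (hU.and hU').exists
  exact h2 h1

/-! ### Evaluation systems -/

/-- A norming family of pairwise non-proportional real lattice homomorphisms on `X` whose pointwise
ultrafilter limits are either zero or of the form `C ^ (-k) • e j` for a natural number `k`. -/
structure IsEvaluationSystem {X : Type*} [NormedAddCommGroup X] [NormedSpace ℝ X] [Lattice X]
    {I : Type*} (C : ℝ) (e : I → X →ₗ[ℝ] ℝ) : Prop where
  one_lt : 1 < C
  norm_le_iff : ∀ (x : X) (r : ℝ), 0 ≤ r → (‖x‖ ≤ r ↔ ∀ i, |e i x| ≤ r)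
  map_sup : ∀ i x y, e i (x ⊔ y) = e i x ⊔ e i y
  map_inf : ∀ i x y, e i (x ⊓ y) = e i x ⊓ e i y
  ne_zero : ∀ i, ∃ x, e i x ≠ 0
  exists_ne_zero : ∀ i j, i ≠ j → ∃ x, e j x = 0 ∧ e i x ≠ 0
  ultrafilter_limit : ∀ U : Ultrafilter I, (∀ x, Tendsto (fun i => e i x) U (𝓝 0)) ∨
    ∃ (j : I) (k : ℕ), ∀ x, Tendsto (fun i => e i x) U (𝓝 (C⁻¹ ^ k * e j x))

/-- The index `i` is isolated: some vector is a unit mass at `i`. -/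
def IsIsolatedIndex {X : Type*} [AddCommGroup X] [Module ℝ X] {I : Type*}
    (e : I → X →ₗ[ℝ] ℝ) (i : I) : Prop :=
  ∃ a : X, e i a = 1 ∧ ∀ j, j ≠ i → e j a = 0

namespace IsEvaluationSystem

variable {X : Type*} [NormedAddCommGroup X] [NormedSpace ℝ X] [Lattice X]
  {I : Type*} {C : ℝ} {e : I → X →ₗ[ℝ] ℝ}

theorem abs_apply_le (h : IsEvaluationSystem C e) (i : I) (x : X) : |e i x| ≤ ‖x‖ :=
  (h.norm_le_iff x ‖x‖ (norm_nonneg x)).1 le_rfl i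

theorem map_abs (h : IsEvaluationSystem C e) (i : I) (x : X) : e i |x| = |e i x| := by
  simp [abs, h.map_sup]

theorem eq_zero (h : IsEvaluationSystem C e) {x : X} (hx : ∀ i, e i x = 0) : x = 0 := by
  have : ‖x‖ ≤ 0 := (h.norm_le_iff x 0 le_rfl).2 fun i => by simp [hx i]
  exact norm_le_zero_iff.1 this

theorem ext (h : IsEvaluationSystem C e) {x y : X} (hx : ∀ i, e i x = e i y) : x = y := by
  rw [← sub_eq_zero]
  exact h.eq_zero fun i => by simp [hx i]

theorem le_iff (h : IsEvaluationSystem C e) {x y : X} : x ≤ y ↔ ∀ i, e i x ≤ e i y := by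
  rw [← sup_eq_right]
  constructor
  · intro hxy i
    rw [← hxy, h.map_sup]
    exact le_sup_left
  · intro hxy
    apply h.ext
    intro i
    rw [h.map_sup, sup_eq_right]
    exact hxy i

theorem nonneg_iff (h : IsEvaluationSystem C e) {x : X} : 0 ≤ x ↔ ∀ i, 0 ≤ e i x := by
  simp [h.le_iff]

theorem continuous_apply (h : IsEvaluationSystem C e) (i : I) : Continuous (e i) :=
  ((e i).mkContinuous 1 fun x => by simpa using h.abs_apply_le i x).continuous

theorem exists_nonneg_eq_one (h : IsEvaluationSystem C e) (i : I) :
    ∃ x, 0 ≤ x ∧ e i x = 1 := by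
  obtain ⟨x, hx⟩ := h.ne_zero i
  refine ⟨|e i x|⁻¹ • |x|, h.nonneg_iff.2 fun j => ?_, ?_⟩
  · simp only [map_smul, h.map_abs, smul_eq_mul]
    positivity
  · simp only [map_smul, h.map_abs, smul_eq_mul]
    exact inv_mul_cancel₀ (abs_ne_zero.2 hx)

theorem exists_nonneg_separating (h : IsEvaluationSystem C e) {i j : I} (hij : i ≠ j) :
    ∃ x, 0 ≤ x ∧ e i x = 1 ∧ e j x = 0 := by
  obtain ⟨x, hx0, hx⟩ := h.exists_ne_zero i j hij
  refine ⟨|e i x|⁻¹ • |x|, h.nonneg_iff.2 fun j => ?_, ?_, ?_⟩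
  · simp only [map_smul, h.map_abs, smul_eq_mul]
    positivity
  · simp only [map_smul, h.map_abs, smul_eq_mul]
    exact inv_mul_cancel₀ (abs_ne_zero.2 hx)
  · simp [h.map_abs, hx0]

/-- The admissible vectors are stable under `⊓`, so it suffices to be below `1 + η` along each
ultrafilter. A limit `C⁻¹ ^ k • e i` takes a value at most one there, and a limit along another `e
j` is killed by an infimum with a vector separating `i` from `j`. -/
theorem exists_bump (h : IsEvaluationSystem C e) (i : I) (F : Finset I) (hF : i ∉ F) {η : ℝ}
    (hη : 0 < η) :
    ∃ x, 0 ≤ x ∧ e i x = 1 ∧ (∀ j ∈ F, e j x = 0) ∧ ‖x‖ ≤ 1 + η := by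
  have hne : ∃ x, 0 ≤ x ∧ e i x = 1 ∧ ∀ j ∈ F, e j x = 0 := by
    classical
    induction F using Finset.induction_on with
    | empty => simpa using h.exists_nonneg_eq_one i
    | insert j F hj ih =>
      rw [Finset.mem_insert, not_or] at hF
      obtain ⟨x, hx, hxi, hxF⟩ := ih hF.2
      obtain ⟨y, hy, hyi, hyj⟩ := h.exists_nonneg_separating hF.1
      refine ⟨x ⊓ y, le_inf hx hy, by simp [h.map_inf, hxi, hyi], fun k hk => ?_⟩
      rw [h.map_inf]
      rcases Finset.mem_insert.1 hk with rfl | hk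
      · rw [hyj]
        exact inf_eq_right.2 (h.nonneg_iff.1 hx k)
      · rw [hxF k hk]
        exact inf_eq_left.2 (h.nonneg_iff.1 hy k)
  have key : ∃ x ∈ {x : X | 0 ≤ x ∧ e i x = 1 ∧ ∀ j ∈ F, e j x = 0},
      ∀ t, e t x < 1 + η := by
    refine exists_forall_of_forall_ultrafilter (fun x t => e t x < 1 + η) hne ?_ ?_
    · rintro x ⟨hx, hxi, hxF⟩ y ⟨hy, hyi, hyF⟩
      refine ⟨x ⊓ y, ⟨le_inf hx hy, by simp [h.map_inf, hxi, hyi], fun k hk => ?_⟩, fun t ht => ?_⟩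
      · simp [h.map_inf, hxF k hk, hyF k hk]
      · rw [h.map_inf]
        exact inf_lt_iff.2 ht
    · intro U
      obtain ⟨x, hx, hxi, hxF⟩ := hne
      rcases h.ultrafilter_limit U with hU | ⟨j, k, hU⟩
      · exact ⟨x, ⟨hx, hxi, hxF⟩, (hU x).eventually_lt_const (by linarith)⟩
      · by_cases hj : j = i
        · subst hj
          refine ⟨x, ⟨hx, hxi, hxF⟩, (hU x).eventually_lt_const ?_⟩
          rw [hxi, mul_one]
          have := pow_le_one₀ (n := k) (inv_nonneg.2 (zero_le_one.trans h.one_lt.le))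
            (inv_le_one_of_one_le₀ h.one_lt.le)
          linarith
        · obtain ⟨y, hy, hyi, hyj⟩ := h.exists_nonneg_separating (Ne.symm hj)
          refine ⟨x ⊓ y, ⟨le_inf hx hy, by simp [h.map_inf, hxi, hyi], fun k hk => ?_⟩,
            (hU _).eventually_lt_const ?_⟩
          · rw [h.map_inf, hxF k hk]
            exact inf_eq_left.2 (h.nonneg_iff.1 hy k)
          · rw [h.map_inf, hyj, inf_eq_right.2 (h.nonneg_iff.1 hx j), mul_zero]
            linarith
  obtain ⟨x, ⟨hx, hxi, hxF⟩, hlt⟩ := key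
  refine ⟨x, hx, hxi, hxF, (h.norm_le_iff x _ (by linarith)).2 fun t => ?_⟩
  rw [abs_of_nonneg (h.nonneg_iff.1 hx t)]
  exact (hlt t).le

/-- If no ultrafilter away from `i` accumulates at a multiple of `e i`, compactness gives positive
vectors with value one at `i` and uniformly small elsewhere. These form a Cauchy sequence whose
limit is a unit mass at `i`. -/
theorem exists_ultrafilter_of_not_isolated [CompleteSpace X] (h : IsEvaluationSystem C e) {i : I}
    (hi : ¬ IsIsolatedIndex e i) :
    ∃ (U : Ultrafilter I) (k : ℕ), (∀ᶠ t in (U : Filter I), t ≠ i) ∧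
      ∀ x, Tendsto (fun t => e t x) U (𝓝 (C⁻¹ ^ k * e i x)) := by
  by_contra! hcon
  apply hi
  have small : ∀ η : ℝ, 0 < η → ∃ x ∈ {x : X | 0 ≤ x ∧ e i x = 1}, ∀ t, t ≠ i → e t x < η := by
    intro η hη
    refine exists_forall_of_forall_ultrafilter (fun x t => t ≠ i → e t x < η)
      (h.exists_nonneg_eq_one i) ?_ ?_
    · rintro x ⟨hx, hxi⟩ y ⟨hy, hyi⟩
      refine ⟨x ⊓ y, ⟨le_inf hx hy, by simp [h.map_inf, hxi, hyi]⟩, fun t ht hti => ?_⟩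
      rw [h.map_inf]
      exact inf_lt_iff.2 (ht.imp (fun f => f hti) (fun f => f hti))
    · intro U
      obtain ⟨x, hx, hxi⟩ := h.exists_nonneg_eq_one i
      rcases h.ultrafilter_limit U with hU | ⟨j, k, hU⟩
      · exact ⟨x, ⟨hx, hxi⟩, ((hU x).eventually_lt_const hη).mono fun t ht _ => ht⟩
      · by_cases hj : j = i
        · subst hj
          by_cases hUj : ∀ᶠ t in (U : Filter I), t ≠ j
          · obtain ⟨x, hx⟩ := hcon U k hUj
            exact absurd (hU x) hx
          · refine ⟨x, ⟨hx, hxi⟩, ?_⟩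
            rw [Ultrafilter.eventually_not, not_not] at hUj
            exact hUj.mono fun t ht hne => absurd ht hne
        · obtain ⟨y, hy, hyi, hyj⟩ := h.exists_nonneg_separating (Ne.symm hj)
          refine ⟨y, ⟨hy, hyi⟩, ((hU y).eventually_lt_const ?_).mono fun t ht _ => ht⟩
          rw [hyj, mul_zero]
          exact hη
  choose y hy hlt using fun n : ℕ => small (1 / ((n : ℝ) + 1)) (by positivity)
  have hcau : CauchySeq y := by
    refine cauchySeq_of_le_tendsto_0 (fun n : ℕ => 1 / ((n : ℝ) + 1)) (fun n m N hn hm => ?_)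
      tendsto_one_div_add_atTop_nhds_zero_nat
    rw [dist_eq_norm]
    refine (h.norm_le_iff _ _ (by positivity)).2 fun t => ?_
    rw [map_sub]
    by_cases ht : t = i
    · subst ht
      rw [(hy n).2, (hy m).2, sub_self, abs_zero]
      positivity
    · have h1 := h.nonneg_iff.1 (hy n).1 t
      have h2 := h.nonneg_iff.1 (hy m).1 t
      have h3 := hlt n t ht
      have h4 := hlt m t ht
      have h5 : 1 / ((n : ℝ) + 1) ≤ 1 / ((N : ℝ) + 1) := Nat.one_div_le_one_div hn
      have h6 : 1 / ((m : ℝ) + 1) ≤ 1 / ((N : ℝ) + 1) := Nat.one_div_le_one_div hm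
      rw [abs_le]
      constructor <;> linarith
  obtain ⟨a, ha⟩ := cauchySeq_tendsto_of_complete hcau
  refine ⟨a, ?_, fun t ht => ?_⟩
  · refine tendsto_nhds_unique (((h.continuous_apply i).tendsto a).comp ha) ?_
    exact tendsto_const_nhds.congr fun n => ((hy n).2).symm
  · refine tendsto_nhds_unique (((h.continuous_apply t).tendsto a).comp ha) ?_
    exact squeeze_zero (fun n => h.nonneg_iff.1 (hy n).1 t) (fun n => (hlt n t ht).le)
      tendsto_one_div_add_atTop_nhds_zero_nat

/-- If `f` is a positive multiple of no `e i`, then no `e i` vanishes on the kernel of `f`. Suprema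
of kernel elements then dominate a positive `x₀` with `f x₀ = 1` up to a small error, so the
positive part of the difference has small norm but `f`-value one. -/
theorem exists_eq_smul_of_map_sup (h : IsEvaluationSystem C e) (f : X →ₗ[ℝ] ℝ)
    (hsup : ∀ x y, f (x ⊔ y) = f x ⊔ f y) (B : ℝ) (hB : ∀ x, |f x| ≤ B * ‖x‖)
    (hne : ∃ x, f x ≠ 0) : ∃ (i : I) (l : ℝ), 0 < l ∧ ∀ x, f x = l * e i x := by
  by_contra! hcon
  have habs : ∀ x, f |x| = |f x| := fun x => by simp [abs, hsup]
  obtain ⟨x₀, hx₀, hfx₀⟩ : ∃ x, 0 ≤ x ∧ f x = 1 := by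
    obtain ⟨x, hx⟩ := hne
    refine ⟨|f x|⁻¹ • |x|, h.nonneg_iff.2 fun j => ?_, ?_⟩
    · simp only [map_smul, h.map_abs, smul_eq_mul]
      positivity
    · simp only [map_smul, habs, smul_eq_mul]
      exact inv_mul_cancel₀ (abs_ne_zero.2 hx)
  have hker : ∀ i, ∃ y, f y = 0 ∧ e i y ≠ 0 := by
    intro i
    by_contra! hi
    have hprop : ∀ x, e i x = f x * e i x₀ := by
      intro x
      have := hi (x - f x • x₀) (by simp [hfx₀])
      simpa [sub_eq_zero] using this
    have hpos : 0 < e i x₀ := by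
      refine lt_of_le_of_ne (h.nonneg_iff.1 hx₀ i) fun h0 => ?_
      obtain ⟨x, hx⟩ := h.ne_zero i
      exact hx (by rw [hprop, ← h0, mul_zero])
    obtain ⟨x, hx⟩ := hcon i (e i x₀)⁻¹ (inv_pos.2 hpos)
    apply hx
    rw [hprop x]
    field_simp
  have small : ∀ η : ℝ, 0 < η → ∃ y ∈ {y : X | 0 ≤ y ∧ f y = 0}, ∀ t, e t x₀ - e t y < η := by
    intro η hη
    refine exists_forall_of_forall_ultrafilter (fun y t => e t x₀ - e t y < η)
      ⟨0, le_rfl, map_zero f⟩ ?_ ?_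
    · rintro x ⟨hx, hxi⟩ y ⟨hy, hyi⟩
      refine ⟨x ⊔ y, ⟨hx.trans le_sup_left, by simp [hsup, hxi, hyi]⟩, fun t ht => ?_⟩
      rw [h.map_sup]
      have h1 : e t x ≤ e t x ⊔ e t y := le_sup_left
      have h2 : e t y ≤ e t x ⊔ e t y := le_sup_right
      rcases ht with ht | ht <;> linarith
    · intro U
      rcases h.ultrafilter_limit U with hU | ⟨j, k, hU⟩
      · refine ⟨0, ⟨le_rfl, map_zero f⟩, ?_⟩
        simpa using (hU x₀).eventually_lt_const hη
      · obtain ⟨y, hy0, hy⟩ := hker j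
        refine ⟨(e j x₀ / |e j y|) • |y|, ⟨h.nonneg_iff.2 fun t => ?_, ?_⟩,
          ((hU _).sub (hU _)).eventually_lt_const ?_⟩
        · simp only [map_smul, h.map_abs, smul_eq_mul]
          have := h.nonneg_iff.1 hx₀ j
          positivity
        · simp [habs, hy0]
        · simp only [map_smul, h.map_abs, smul_eq_mul]
          rw [div_mul_cancel₀ _ (abs_ne_zero.2 hy), sub_self]
          exact hη
  have hBpos : 0 < B := by
    have h1 := hB x₀
    rw [hfx₀, abs_one] at h1
    by_contra hB0
    have := mul_nonpos_of_nonpos_of_nonneg (not_lt.1 hB0) (norm_nonneg x₀)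
    linarith
  -- With this error the bound on `f` gives `1 ≤ B * (1 / (2 * B)) = 1 / 2`.
  obtain ⟨y, ⟨hy, hfy⟩, hlt⟩ := small (1 / (2 * B)) (by positivity)
  have hnorm : ‖(x₀ - y) ⊔ 0‖ ≤ 1 / (2 * B) := by
    refine (h.norm_le_iff _ _ (by positivity)).2 fun t => ?_
    rw [h.map_sup, map_zero, map_sub, abs_of_nonneg le_sup_right]
    exact sup_le (hlt t).le (by positivity)
  have hval : f ((x₀ - y) ⊔ 0) = 1 := by
    rw [hsup, map_sub, hfx₀, hfy, map_zero]
    simp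
  have h1 := hB ((x₀ - y) ⊔ 0)
  rw [hval, abs_one] at h1
  have h2 : B * ‖(x₀ - y) ⊔ 0‖ ≤ B * (1 / (2 * B)) := mul_le_mul_of_nonneg_left hnorm hBpos.le
  have h3 : B * (1 / (2 * B)) = 1 / 2 := by field_simp
  linarith

end IsEvaluationSystem

namespace IsEvaluationSystem

variable {X : Type*} [NormedAddCommGroup X] [NormedSpace ℝ X] [Lattice X]
  {I : Type*} {C : ℝ} {e : I → X →ₗ[ℝ] ℝ}

/-- For each vector of a dense sequence, choose an index that norms it up to a factor of two. -/
theorem exists_countable_separating [SeparableSpace X] (h : IsEvaluationSystem C e) :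
    ∃ J : Set I, J.Countable ∧ ∀ x, (∀ i ∈ J, e i x = 0) → x = 0 := by
  rcases isEmpty_or_nonempty I with hI | hI
  · exact ⟨∅, Set.countable_empty, fun x _ => h.eq_zero fun i => isEmptyElim i⟩
  have hex : ∀ n : ℕ, ∃ i, ‖denseSeq X n‖ ≤ 2 * |e i (denseSeq X n)| := by
    intro n
    by_contra! hn
    obtain ⟨i⟩ := hI
    have h0 : ‖denseSeq X n‖ ≤ ‖denseSeq X n‖ / 2 :=
      (h.norm_le_iff _ _ (by positivity)).2 fun i => by linarith [hn i]
    linarith [hn i, abs_nonneg (e i (denseSeq X n))]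
  choose g hg using hex
  refine ⟨Set.range g, Set.countable_range g, fun x hx => ?_⟩
  rw [← norm_le_zero_iff]
  refine le_of_forall_pos_le_add fun η hη => ?_
  obtain ⟨n, hn⟩ := (denseRange_denseSeq X).exists_dist_lt x (show 0 < η / 3 by positivity)
  rw [dist_eq_norm] at hn
  have h1 := h.abs_apply_le (g n) (x - denseSeq X n)
  rw [map_sub, hx _ ⟨n, rfl⟩, zero_sub, abs_neg] at h1
  have h2 := norm_le_norm_add_norm_sub' x (denseSeq X n)
  linarith [hg n]

end IsEvaluationSystem

/-! ### From Benyamini spaces to evaluation systems -/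

theorem IsBenyaminiSpace.exists_isEvaluationSystem {X : Type u} [NormedAddCommGroup X]
    [NormedSpace ℝ X] [Lattice X] {C : ℝ} (hX : IsBenyaminiSpace.{u, v} C X) :
    ∃ (I : Type v) (e : I → X →ₗ[ℝ] ℝ), IsEvaluationSystem C e := by
  obtain ⟨hC, K, _, _, _, J, hsup, hinf, hinfty, hsep, hprop⟩ := hX
  have hC0 : C ≠ 0 := (zero_lt_one.trans hC).ne'
  let E : (Σ n, K n) → X →ₗ[ℝ] ℝ := fun s =>
    { toFun := fun x => J x (OnePoint.some s)
      map_add' := fun x y => by simp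
      map_smul' := fun r x => by simp }
  have hE : ∀ s x, E s x = J x (OnePoint.some s) := fun _ _ => rfl
  -- Points of lowest level in their proportionality class. Every other evaluation is such a one
  -- times a nonpositive power of `C`, so the norm is unchanged. Two proportional canonical points
  -- share a level, hence have ratio `C ^ 0 = 1` and coincide by separation.
  let Can : (Σ n, K n) → Prop := fun s => ∀ t l, (∀ x, E s x = l * E t x) → s.1 ≤ t.1
  have hprop' : ∀ s t l, (∀ x, E s x = l * E t x) → l = C ^ ((t.1 : ℤ) - (s.1 : ℤ)) :=
    fun s t l hl => hprop s.1 t.1 s.2 t.2 l hl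
  have hcan : ∀ s, ∃ t, Can t ∧ ∃ k : ℕ, ∀ x, E s x = C⁻¹ ^ k * E t x := by
    classical
    intro s
    have hex : ∃ n, ∃ t : Σ n, K n, t.1 = n ∧ ∃ l, ∀ x, E s x = l * E t x :=
      ⟨s.1, s, rfl, 1, fun x => (one_mul _).symm⟩
    obtain ⟨t, ht, l, hl⟩ := Nat.find_spec hex
    refine ⟨t, fun u m hm => ?_, s.1 - t.1, fun x => ?_⟩
    · rw [ht]
      exact Nat.find_min' hex ⟨u, rfl, l * m, fun x => by rw [hl, hm, mul_assoc]⟩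
    · have hle : t.1 ≤ s.1 := by
        rw [ht]
        exact Nat.find_min' hex ⟨s, rfl, 1, fun x => (one_mul _).symm⟩
      rw [hl x, hprop' s t l hl, inv_pow, ← zpow_natCast, ← zpow_neg, Nat.cast_sub hle, neg_sub]
  -- A vanishing evaluation would be proportional to itself with constant zero, which is not a power
  -- of `C`.
  have hne : ∀ s, ∃ x, E s x ≠ 0 := by
    intro s
    by_contra! hs
    have := hprop' s s 0 fun x => by rw [hs, zero_mul]
    simp at this
  have hnp : ∀ s t : {s // Can s}, s ≠ t → ∃ x, E t x = 0 ∧ E s x ≠ 0 := by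
    intro s t hst
    by_contra! hcon
    obtain ⟨x₀, hx₀⟩ := hne t
    have hs : ∀ x, E s x = (E s x₀ / E t x₀) * E t x := by
      intro x
      have h1 := hcon (x - (E t x / E t x₀) • x₀) (by simp [hx₀])
      rw [map_sub, map_smul, smul_eq_mul, sub_eq_zero] at h1
      rw [h1]
      ring
    have hl := hprop' _ _ _ hs
    have hl0 : E s x₀ / E t x₀ ≠ 0 := by
      rw [hl]
      exact zpow_ne_zero _ hC0
    have hlen : s.1.1 = t.1.1 := by
      refine le_antisymm (s.2 _ _ hs) (t.2 s (E s x₀ / E t x₀)⁻¹ fun x => ?_)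
      rw [hs x, inv_mul_cancel_left₀ hl0]
    rw [hlen, sub_self, zpow_zero] at hl
    rw [hl] at hs
    obtain ⟨⟨n, s⟩, hs'⟩ := s
    obtain ⟨⟨m, t⟩, ht'⟩ := t
    obtain rfl : n = m := hlen
    have hst' : s ≠ t := by
      rintro rfl
      exact hst rfl
    obtain ⟨x, hx⟩ := hsep n s t hst'
    exact hx (by simpa [hE] using hs x)
  refine ⟨{s // Can s}, fun s => E s, hC, fun x r hr => ?_, fun s x y => ?_, fun s x y => ?_,
    fun s => hne s, hnp, fun U => ?_⟩
  · rw [← J.norm_map, ContinuousMap.norm_le _ hr]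
    constructor
    · exact fun hx s => hx _
    · intro hx p
      induction p using OnePoint.rec with
      | infty => simpa [hinfty] using hr
      | coe s =>
        obtain ⟨t, ht, k, hk⟩ := hcan s
        change |E s x| ≤ r
        rw [hk x, abs_mul, abs_of_nonneg (by positivity)]
        have h1 : C⁻¹ ^ k ≤ 1 :=
          pow_le_one₀ (by positivity) (inv_le_one_of_one_le₀ hC.le)
        exact (mul_le_of_le_one_left (abs_nonneg _) h1).trans (hx ⟨t, ht⟩)
  · simp [hE, hsup]
  · simp [hE, hinf]
  · obtain ⟨p, -, hp⟩ := isCompact_univ.ultrafilter_le_nhds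
      (U.map fun s : {s // Can s} => (OnePoint.some s.1 : OnePoint (Σ n, K n))) (by simp)
    have hlim : ∀ x, Tendsto (fun s : {s // Can s} => E s x) U (𝓝 (J x p)) := fun x =>
      ((J x).continuous.tendsto p).comp (show Tendsto _ (U : Filter {s // Can s}) (𝓝 p) from hp)
    induction p using OnePoint.rec with
    | infty => exact Or.inl fun x => by simpa [hinfty] using hlim x
    | coe s =>
      obtain ⟨t, ht, k, hk⟩ := hcan s
      exact Or.inr ⟨⟨t, ht⟩, k, fun x => by rw [← hk x]; exact hlim x⟩

/-! ### The perturbation data and the new norm -/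

/-- Data for a rigid renorming: `b` collapses the isolated indices to one of them and fixes the
other indices, and the perturbations `ε` are small, tend to zero, and determine the index. -/
structure IsRigidPerturbation {X : Type*} [AddCommGroup X] [Module ℝ X] {I : Type*}
    (C : ℝ) (e : I → X →ₗ[ℝ] ℝ) (b : I → I) (ε : I → ℝ) : Prop where
  nonneg : ∀ i, 0 ≤ ε i
  le_half : ∀ i, ε i ≤ 1 / 2
  one_add_lt : ∀ i, 1 + ε i < C
  finite : ∀ η, 0 < η → {i | η ≤ ε i}.Finite
  injective : ∀ i j, 0 < ε i → ε i = ε j → i = j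
  base_of_not_isolated : ∀ i, ¬ IsIsolatedIndex e i → b i = i
  base_isolated : ∀ i, IsIsolatedIndex e i → IsIsolatedIndex e (b i)
  base_eq : ∀ i j, IsIsolatedIndex e i → IsIsolatedIndex e j → b i = b j
  eps_base : ∀ i, IsIsolatedIndex e i → ε (b i) = 0
  pos_of_isolated : ∀ i, IsIsolatedIndex e i → b i ≠ i → 0 < ε i
  separating : ∀ x, (∀ i, IsIsolatedIndex e i ∨ 0 < ε i → e i x = 0) → x = 0

theorem IsEvaluationSystem.exists_isRigidPerturbation {X : Type*} [NormedAddCommGroup X]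
    [NormedSpace ℝ X] [Lattice X] [SeparableSpace X] {I : Type*} {C : ℝ} {e : I → X →ₗ[ℝ] ℝ}
    (h : IsEvaluationSystem C e) {δ : ℝ} (hδ : 0 < δ) :
    ∃ (b : I → I) (ε : I → ℝ), IsRigidPerturbation C e b ε ∧ ∀ i, ε i ≤ δ := by
  classical
  obtain ⟨J, hJ, hsep⟩ := h.exists_countable_separating
  -- A unit mass at `i` is killed by all other evaluations, so a separating set cannot omit `i`.
  have hiso : ∀ i, IsIsolatedIndex e i → i ∈ J := by
    rintro i ⟨a, ha, ha'⟩
    by_contra hi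
    have : a = 0 := hsep a fun j hj => ha' j (by rintro rfl; exact hi hj)
    simp [this] at ha
  -- The base index; `none` when there are no isolated indices.
  obtain ⟨o, ho', ho⟩ : ∃ o : Option I, (∀ j ∈ o, IsIsolatedIndex e j) ∧
      ∀ i, IsIsolatedIndex e i → ∃ j ∈ o, IsIsolatedIndex e j := by
    by_cases hex : ∃ i, IsIsolatedIndex e i
    · obtain ⟨i, hi⟩ := hex
      refine ⟨some i, fun j hj => ?_, fun _ _ => ⟨i, rfl, hi⟩⟩
      obtain rfl : i = j := Option.some_inj.1 hj
      exact hi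
    · exact ⟨none, fun j hj => (by simp at hj), fun i hi => absurd ⟨i, hi⟩ hex⟩
  obtain ⟨g, hg⟩ := Set.countable_iff_exists_injOn.1 hJ
  set m : ℝ := min δ (min (1 / 2) ((C - 1) / 2))
  have hC := h.one_lt
  have hm0 : 0 < m := lt_min hδ (lt_min (by norm_num) (by linarith))
  have hm1 : m ≤ δ := min_le_left _ _
  have hm2 : m ≤ 1 / 2 := (min_le_right _ _).trans (min_le_left _ _)
  have hm3 : m ≤ (C - 1) / 2 := (min_le_right _ _).trans (min_le_right _ _)
  -- As `g` is injective on `J`, the positive values are distinct and only finitely many exceed a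
  -- given bound.
  let ε : I → ℝ := fun i => if i ∈ J ∧ i ∉ o then m / (g i + 1) else 0
  have hpos : ∀ i, i ∈ J ∧ i ∉ o → ε i = m / (g i + 1) := fun i hi => if_pos hi
  have hzero : ∀ i, ¬ (i ∈ J ∧ i ∉ o) → ε i = 0 := fun i hi => if_neg hi
  have hpos' : ∀ i, i ∈ J ∧ i ∉ o → 0 < ε i := fun i hi => by
    rw [hpos i hi]
    positivity
  have hmem : ∀ i, 0 < ε i → i ∈ J ∧ i ∉ o := fun i hi => by
    by_contra hcon
    exact hi.ne' (hzero i hcon)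
  have hle : ∀ i, ε i ≤ m := by
    intro i
    by_cases hi : i ∈ J ∧ i ∉ o
    · rw [hpos i hi]
      exact div_le_self hm0.le (by linarith [(g i).cast_nonneg (α := ℝ)])
    · rw [hzero i hi]
      exact hm0.le
  have hb : ∀ i, IsIsolatedIndex e i → o = some (o.getD i) ∧ IsIsolatedIndex e (o.getD i) := by
    intro i hi
    obtain ⟨j, hj, hj'⟩ := ho i hi
    obtain rfl : o = some j := hj
    exact ⟨rfl, hj'⟩
  refine ⟨fun i => if IsIsolatedIndex e i then o.getD i else i, ε, ?_, fun i => (hle i).trans hm1⟩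
  refine ⟨fun i => ?_, fun i => (hle i).trans hm2, fun i => by linarith [hle i],
    fun η hη => ?_, fun i j hi hij => ?_, fun i hi => if_neg hi, fun i hi => ?_,
    fun i j hi hj => ?_, fun i hi => ?_, fun i hi hne => ?_, fun x hx => ?_⟩
  · by_cases hi : i ∈ J ∧ i ∉ o
    · exact (hpos' i hi).le
    · exact (hzero i hi).ge
  · refine Set.Finite.of_finite_image (f := g) ((Set.finite_Iic ⌊m / η⌋₊).subset ?_) ?_
    · rintro _ ⟨i, hi, rfl⟩
      have hi' : η ≤ ε i := hi
      rw [hpos i (hmem i (hη.trans_le hi')), le_div_iff₀ (by positivity)] at hi'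
      refine Nat.le_floor ?_
      rw [le_div_iff₀ hη]
      nlinarith
    · exact hg.mono fun i hi => (hmem i (hη.trans_le hi)).1
  · have hi' := hmem i hi
    have hj' := hmem j (hij ▸ hi)
    rw [hpos i hi', hpos j hj', div_eq_div_iff (by positivity) (by positivity)] at hij
    have hij' := mul_left_cancel₀ hm0.ne' hij
    rw [add_left_inj, Nat.cast_inj] at hij'
    exact hg hi'.1 hj'.1 hij'.symm
  · simp only [if_pos hi]
    exact (hb i hi).2
  · simp only [if_pos hi, if_pos hj]
    rw [← Option.some_inj, ← (hb i hi).1, ← (hb j hj).1]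
  · simp only [if_pos hi]
    exact hzero _ fun hcon => hcon.2 (hb i hi).1
  · simp only [if_pos hi] at hne
    refine hpos' i ⟨hiso i hi, fun hcon => hne ?_⟩
    rw [← Option.some_inj, ← (hb i hi).1]
    exact hcon
  · refine hsep x fun i hi => hx i ?_
    by_cases hio : i ∈ o
    · exact Or.inl (ho' i hio)
    · exact Or.inr (hpos' i ⟨hi, hio⟩)

/-- The seminorm `max ‖x‖ (sup_i (|e (b i) x| + ε i * |e i x|))`. -/
noncomputable def perturbedNorm {X : Type*} [NormedAddCommGroup X] [NormedSpace ℝ X]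
    {I : Type*} (e : I → X →ₗ[ℝ] ℝ) (b : I → I) (ε : I → ℝ) : Seminorm ℝ X :=
  normSeminorm ℝ X ⊔ ⨆ i, ((normSeminorm ℝ ℝ).comp (e (b i)) +
    (ε i).toNNReal • (normSeminorm ℝ ℝ).comp (e i))

theorem IsEvaluationSystem.perturbedNorm_le_iff {X : Type*} [NormedAddCommGroup X]
    [NormedSpace ℝ X] [Lattice X] {I : Type*} {C : ℝ} {e : I → X →ₗ[ℝ] ℝ}
    (h : IsEvaluationSystem C e) {b : I → I} {ε : I → ℝ} (hε : ∀ i, 0 ≤ ε i)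
    {δ : ℝ} (hεδ : ∀ i, ε i ≤ δ) (x : X) (r : ℝ) :
    perturbedNorm e b ε x ≤ r ↔ ‖x‖ ≤ r ∧ ∀ i, |e (b i) x| + ε i * |e i x| ≤ r := by
  have hval : ∀ i y, ((normSeminorm ℝ ℝ).comp (e (b i)) +
      (ε i).toNNReal • (normSeminorm ℝ ℝ).comp (e i)) y = |e (b i) y| + ε i * |e i y| := by
    intro i y
    simp [NNReal.smul_def, hε i]
  have hle : ∀ i y, |e (b i) y| + ε i * |e i y| ≤ (1 + δ) * ‖y‖ := by
    intro i y
    have h1 := h.abs_apply_le (b i) y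
    have h2 := mul_le_mul (hεδ i) (h.abs_apply_le i y) (abs_nonneg _) ((hε i).trans (hεδ i))
    linarith
  have hbdd : BddAbove (Set.range fun i => ((normSeminorm ℝ ℝ).comp (e (b i)) +
      (ε i).toNNReal • (normSeminorm ℝ ℝ).comp (e i))) := by
    rw [Seminorm.bddAbove_range_iff]
    intro y
    refine ⟨(1 + δ) * ‖y‖, ?_⟩
    rintro _ ⟨i, rfl⟩
    simp only [hval]
    exact hle i y
  rw [perturbedNorm, Seminorm.sup_apply, sup_le_iff, coe_normSeminorm, Seminorm.iSup_apply hbdd]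
  simp only [hval]
  refine and_congr_right fun hx => ⟨fun hs i => ?_, fun hs => ?_⟩
  · refine (le_ciSup (f := fun i => |e (b i) x| + ε i * |e i x|) ?_ i).trans hs
    refine ⟨(1 + δ) * ‖x‖, ?_⟩
    rintro _ ⟨i, rfl⟩
    exact hle i x
  · exact Real.iSup_le hs ((norm_nonneg x).trans hx)

/-- An ultrafilter containing a finite set is principal, so its limit would make `e i` proportional
to another evaluation. -/
theorem IsEvaluationSystem.eventually_notMem_finite {X : Type*} [NormedAddCommGroup X]
    [NormedSpace ℝ X] [Lattice X] {I : Type*} {C : ℝ} {e : I → X →ₗ[ℝ] ℝ}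
    (h : IsEvaluationSystem C e) {U : Ultrafilter I} {i : I}
    (hU : ∀ᶠ t in (U : Filter I), t ≠ i) {l : ℝ} (hl : l ≠ 0) (f : I → ℝ)
    (hlim : ∀ x, Tendsto (fun t => f t * e t x) U (𝓝 (l * e i x))) {F : Set I} (hF : F.Finite) :
    ∀ᶠ t in (U : Filter I), t ∉ F := by
  by_contra hcon
  rw [Ultrafilter.eventually_not, not_not] at hcon
  obtain ⟨j, -, hj⟩ := (Ultrafilter.finite_biUnion_mem_iff (s := fun j => ({j} : Set I)) hF).1
    (by simpa using hcon)
  have hj' : ∀ᶠ t in (U : Filter I), t = j := hj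
  obtain ⟨t, rfl, hti⟩ := (hj'.and hU).exists
  obtain ⟨x, hxt, hxi⟩ := h.exists_ne_zero i t (Ne.symm hti)
  refine mul_ne_zero hl hxi (tendsto_nhds_unique (hlim x) ?_)
  exact tendsto_const_nhds.congr' (hj'.mono fun s hs => by simp [show s = t from hs, hxt])

/-- The interval `[1, C)` is a fundamental domain for multiplication by powers of `C`. -/
theorem eq_of_mul_pow_eq_mul_pow {C a b : ℝ} (hC : 1 < C) (ha : 1 ≤ a) (haC : a < C)
    (hb : 1 ≤ b) (hbC : b < C) {m n : ℕ} (h : a * C ^ m = b * C ^ n) : a = b := by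
  have key : ∀ {a b : ℝ} {m n : ℕ}, 1 ≤ a → b < C → a * C ^ m = b * C ^ n → m ≤ n := by
    intro a b m n ha hb h
    by_contra! hmn
    have h1 : C ^ (n + 1) ≤ C ^ m := pow_le_pow_right₀ hC.le hmn
    have h2 : 0 < C ^ n := by positivity
    have h3 : C ^ (n + 1) = C * C ^ n := pow_succ' C n
    have h4 : C ^ m ≤ a * C ^ m := le_mul_of_one_le_left (by positivity) ha
    linarith [mul_lt_mul_of_pos_right hb h2]
  obtain rfl : m = n := le_antisymm (key ha hbC h) (key hb haC h.symm)
  exact mul_right_cancel₀ (by positivity) h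

open Classical in
/-- The reciprocal of the dual norm of `e i` for `perturbedNorm e b ε`. -/
noncomputable def perturbedWeight {X : Type*} [AddCommGroup X] [Module ℝ X] {I : Type*}
    (e : I → X →ₗ[ℝ] ℝ) (ε : I → ℝ) (i : I) : ℝ :=
  if IsIsolatedIndex e i then 1 else 1 + ε i

/-! ### Weights and properties of the new norm -/

namespace IsRigidPerturbation

theorem one_le_weight {X : Type*} [AddCommGroup X] [Module ℝ X] {I : Type*} {C : ℝ}
    {e : I → X →ₗ[ℝ] ℝ} {b : I → I} {ε : I → ℝ} (hε : IsRigidPerturbation C e b ε) (i : I) :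
    1 ≤ perturbedWeight e ε i := by
  unfold perturbedWeight
  split_ifs
  · exact le_rfl
  · linarith [hε.nonneg i]

theorem weight_le {X : Type*} [AddCommGroup X] [Module ℝ X] {I : Type*} {C : ℝ}
    {e : I → X →ₗ[ℝ] ℝ} {b : I → I} {ε : I → ℝ} (hε : IsRigidPerturbation C e b ε) (i : I) :
    perturbedWeight e ε i ≤ 1 + ε i := by
  unfold perturbedWeight
  split_ifs
  · linarith [hε.nonneg i]
  · exact le_rfl

theorem tendsto_weight {X : Type*} [AddCommGroup X] [Module ℝ X] {I : Type*} {C : ℝ}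
    {e : I → X →ₗ[ℝ] ℝ} {b : I → I} {ε : I → ℝ} (hε : IsRigidPerturbation C e b ε)
    {L : Filter I} (hL : ∀ {F : Set I}, F.Finite → ∀ᶠ t in L, t ∉ F) :
    Tendsto (perturbedWeight e ε) L (𝓝 1) := by
  rw [Metric.tendsto_nhds]
  intro η hη
  filter_upwards [hL (hε.finite η hη)] with t ht
  have h1 := hε.one_le_weight t
  have h2 := hε.weight_le t
  have h3 : ε t < η := not_le.1 ht
  rw [Real.dist_eq, abs_lt]
  constructor <;> linarith

variable {X : Type*} [NormedAddCommGroup X] [NormedSpace ℝ X] [Lattice X]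
  {I : Type*} {C : ℝ} {e : I → X →ₗ[ℝ] ℝ} {b : I → I} {ε : I → ℝ}

theorem perturbedNorm_le_iff (hε : IsRigidPerturbation C e b ε) (h : IsEvaluationSystem C e)
    (x : X) (r : ℝ) :
    perturbedNorm e b ε x ≤ r ↔ ‖x‖ ≤ r ∧ ∀ i, |e (b i) x| + ε i * |e i x| ≤ r :=
  h.perturbedNorm_le_iff hε.nonneg hε.le_half x r

theorem norm_le_perturbedNorm (hε : IsRigidPerturbation C e b ε) (h : IsEvaluationSystem C e)
    (x : X) : ‖x‖ ≤ perturbedNorm e b ε x :=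
  ((hε.perturbedNorm_le_iff h x _).1 le_rfl).1

theorem perturbedNorm_le_mul (hε : IsRigidPerturbation C e b ε) (h : IsEvaluationSystem C e)
    {δ : ℝ} (hδ : 0 ≤ δ) (hεδ : ∀ i, ε i ≤ δ) (x : X) :
    perturbedNorm e b ε x ≤ (1 + δ) * ‖x‖ := by
  refine (hε.perturbedNorm_le_iff h x _).2
    ⟨le_mul_of_one_le_left (norm_nonneg x) (by linarith), fun i => ?_⟩
  have h1 := h.abs_apply_le (b i) x
  have h2 := mul_le_mul (hεδ i) (h.abs_apply_le i x) (abs_nonneg _) hδ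
  linarith

theorem isLatticeNorm (hε : IsRigidPerturbation C e b ε) (h : IsEvaluationSystem C e) :
    IsLatticeNorm (perturbedNorm e b ε) where
  definite x hx := norm_le_zero_iff.1 ((hε.norm_le_perturbedNorm h x).trans hx.le)
  solid x y hxy := by
    have hle : ∀ i, |e i x| ≤ |e i y| := fun i => by
      simpa only [h.map_abs] using h.le_iff.1 hxy i
    obtain ⟨h1, h2⟩ := (hε.perturbedNorm_le_iff h y _).1 le_rfl
    refine (hε.perturbedNorm_le_iff h x _).2 ⟨(h.norm_le_iff _ _ (apply_nonneg _ y)).2 fun i =>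
      (hle i).trans ((h.abs_apply_le i y).trans h1), fun i => ?_⟩
    exact (add_le_add (hle _) (mul_le_mul_of_nonneg_left (hle i) (hε.nonneg i))).trans (h2 i)

/-- With at most one isolated index `b` is the identity, so the norm is a supremum of multiples of
single `|e i x|`, and each `e i` turns `⊔` into a maximum. -/
theorem isAMNorm (hε : IsRigidPerturbation C e b ε) (h : IsEvaluationSystem C e)
    (hiso : ∀ i j, IsIsolatedIndex e i → IsIsolatedIndex e j → i = j) :
    IsAMNorm (perturbedNorm e b ε) where
  toIsLatticeNorm := hε.isLatticeNorm h
  sup_eq x y hx hy := by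
    have hb : ∀ i, b i = i := fun i => by
      by_cases hi : IsIsolatedIndex e i
      · exact hiso _ _ (hε.base_isolated i hi) hi
      · exact hε.base_of_not_isolated i hi
    have hmono : ∀ u v : X, 0 ≤ u → u ≤ v → perturbedNorm e b ε u ≤ perturbedNorm e b ε v := by
      intro u v hu huv
      refine (hε.isLatticeNorm h).solid u v (h.le_iff.2 fun i => ?_)
      rw [h.map_abs, h.map_abs, abs_of_nonneg (h.nonneg_iff.1 hu i),
        abs_of_nonneg (h.nonneg_iff.1 (hu.trans huv) i)]
      exact h.le_iff.1 huv i
    refine le_antisymm ?_ (max_le (hmono _ _ hx le_sup_left) (hmono _ _ hy le_sup_right))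
    obtain ⟨hx1, hx2⟩ := (hε.perturbedNorm_le_iff h x _).1 le_rfl
    obtain ⟨hy1, hy2⟩ := (hε.perturbedNorm_le_iff h y _).1 le_rfl
    have hcase : ∀ i, e i (x ⊔ y) = e i x ∨ e i (x ⊔ y) = e i y := fun i => by
      rw [h.map_sup]
      exact max_choice _ _
    refine (hε.perturbedNorm_le_iff h _ _).2
      ⟨(h.norm_le_iff _ _ (le_max_of_le_left (apply_nonneg _ x))).2 fun i => ?_, fun i => ?_⟩
    · rcases hcase i with hi | hi <;> rw [hi]
      · exact le_max_of_le_left ((h.abs_apply_le i x).trans hx1)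
      · exact le_max_of_le_right ((h.abs_apply_le i y).trans hy1)
    · have h1 := hx2 i
      have h2 := hy2 i
      rw [hb] at h1 h2 ⊢
      rcases hcase i with hi | hi <;> rw [hi]
      · exact le_max_of_le_left h1
      · exact le_max_of_le_right h2

theorem weight_mul_abs_le (hε : IsRigidPerturbation C e b ε) (h : IsEvaluationSystem C e)
    (i : I) (x : X) : perturbedWeight e ε i * |e i x| ≤ perturbedNorm e b ε x := by
  obtain ⟨h1, h2⟩ := (hε.perturbedNorm_le_iff h x _).1 le_rfl
  unfold perturbedWeight
  split_ifs with hi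
  · rw [one_mul]
    exact (h.abs_apply_le i x).trans h1
  · have h3 := h2 i
    rw [hε.base_of_not_isolated i hi] at h3
    linarith

/-- With `weight_mul_abs_le`, this says that the normalized evaluation has dual norm one. The
witness is the unit mass at an isolated `i`, and otherwise a rescaled bump vanishing at the base and
at the other indices with large `ε`. -/
theorem exists_weight_mul_eq_one (hε : IsRigidPerturbation C e b ε) (h : IsEvaluationSystem C e)
    (i : I) {η : ℝ} (hη : 0 < η) :
    ∃ x, perturbedWeight e ε i * e i x = 1 ∧ perturbedNorm e b ε x ≤ 1 + η := by
  by_cases hi : IsIsolatedIndex e i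
  · obtain ⟨a, ha, ha'⟩ := id hi
    have hle : ∀ j, |e j a| ≤ 1 := fun j => by
      by_cases hj : j = i
      · rw [hj, ha, abs_one]
      · rw [ha' j hj, abs_zero]
        exact zero_le_one
    refine ⟨a, by rw [perturbedWeight, if_pos hi, one_mul, ha],
      (hε.perturbedNorm_le_iff h _ _).2 ⟨((h.norm_le_iff _ _ zero_le_one).2 hle).trans
        (by linarith), fun j => ?_⟩⟩
    refine le_trans ?_ (show (1 : ℝ) ≤ 1 + η by linarith)
    have hj0 := hε.nonneg j
    have hj1 := hε.le_half j
    by_cases hj : b j = i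
    · by_cases hji : j = i
      · have : ε i = 0 := by
          have := hε.eps_base i hi
          rwa [← hji, hj] at this
        rw [hj, hji, this, ha]
        simp
      · rw [hj, ha' j hji, ha]
        simp
    · rw [ha' _ hj, abs_zero, zero_add]
      nlinarith [hle j, abs_nonneg (e j a)]
  -- Where `ε j < η'`, the term is at most `(1 + η') ^ 2 ≤ 1 + 3 * η'`.
  · obtain ⟨η', hη', hη'1, hη'2⟩ : ∃ η' : ℝ, 0 < η' ∧ η' ≤ 1 ∧ 3 * η' ≤ η :=
      ⟨min 1 (η / 3), by positivity, min_le_left _ _, by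
        linarith [min_le_right 1 (η / 3)]⟩
    classical
    set F : Finset I := ((hε.finite η' hη').toFinset ∪
      (if hA : ∃ j, IsIsolatedIndex e j then {b hA.choose} else ∅)).erase i with hF
    obtain ⟨x, hx, hxi, hxF, hxn⟩ := h.exists_bump i F (Finset.notMem_erase i _) hη'
    have hxF' : ∀ j, η' ≤ ε j → j ≠ i → e j x = 0 := fun j hj hji => hxF j <| by
      rw [hF, Finset.mem_erase, Finset.mem_union, Set.Finite.mem_toFinset]
      exact ⟨hji, Or.inl hj⟩
    have hxb : ∀ j, IsIsolatedIndex e j → e (b j) x = 0 := fun j hj => hxF _ <| by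
      have hA : ∃ j, IsIsolatedIndex e j := ⟨j, hj⟩
      rw [hF, Finset.mem_erase, Finset.mem_union, dif_pos hA, Finset.mem_singleton]
      refine ⟨?_, Or.inr (hε.base_eq _ _ hj hA.choose_spec)⟩
      intro hbi
      exact hi (hbi ▸ hε.base_isolated j hj)
    have hx1 : ∀ j, |e j x| ≤ 1 + η' := fun j => (h.abs_apply_le j x).trans hxn
    have hεi := hε.nonneg i
    have hNx : perturbedNorm e b ε x ≤ (1 + ε i) * (1 + η) := by
      have hmul : 0 ≤ ε i * η := mul_nonneg hεi hη.le
      refine (hε.perturbedNorm_le_iff h _ _).2 ⟨by nlinarith, fun j => ?_⟩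
      have hj0 := hε.nonneg j
      have hj1 := hε.le_half j
      by_cases hj : IsIsolatedIndex e j
      · rw [hxb j hj, abs_zero, zero_add]
        nlinarith [hx1 j, abs_nonneg (e j x)]
      · rw [hε.base_of_not_isolated j hj]
        by_cases hji : j = i
        · rw [hji, hxi, abs_one]
          nlinarith
        · by_cases hjη : η' ≤ ε j
          · rw [hxF' j hjη hji]
            simp only [abs_zero, mul_zero, add_zero]
            nlinarith
          · have h3 : ε j * |e j x| ≤ η' * (1 + η') :=
              mul_le_mul (not_le.1 hjη).le (hx1 j) (abs_nonneg _) hη'.le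
            nlinarith [hx1 j]
    have hw : perturbedWeight e ε i = 1 + ε i := if_neg hi
    have hwpos : 0 < 1 + ε i := by linarith
    refine ⟨(1 + ε i)⁻¹ • x, ?_, ?_⟩
    · rw [hw, map_smul, hxi, smul_eq_mul, mul_one, mul_inv_cancel₀ hwpos.ne']
    · rw [map_smul_eq_mul, norm_inv, Real.norm_of_nonneg hwpos.le, inv_mul_le_iff₀ hwpos]
      exact hNx

/-! ### Lattice isometries permute the normalized evaluations -/

theorem eq_of_weight_mul_eq (hε : IsRigidPerturbation C e b ε) (h : IsEvaluationSystem C e)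
    {i j : I} {l : ℝ} (hl : l ≠ 0) (hij : ∀ x, perturbedWeight e ε i * e i x =
      l * (perturbedWeight e ε j * e j x)) : i = j := by
  by_contra hne
  obtain ⟨x, hxj, hxi⟩ := h.exists_ne_zero j i (Ne.symm hne)
  have := hij x
  have hw := hε.one_le_weight j
  rw [hxj, mul_zero] at this
  have h1 : l * (perturbedWeight e ε j * e j x) ≠ 0 :=
    mul_ne_zero hl (mul_ne_zero (by linarith) hxi)
  exact h1 this.symm

theorem exists_index_map (hε : IsRigidPerturbation C e b ε) (h : IsEvaluationSystem C e)
    {T : X →ₗ[ℝ] X} (hT : IsLatticeIsometry (perturbedNorm e b ε) T) :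
    ∃ φ : I → I, ∀ i x,
      perturbedWeight e ε i * e i (T x) = perturbedWeight e ε (φ i) * e (φ i) x := by
  suffices hs : ∀ i, ∃ j, ∀ x,
      perturbedWeight e ε i * e i (T x) = perturbedWeight e ε j * e j x by
    choose φ hφ using hs
    exact ⟨φ, hφ⟩
  intro i
  have hwi := hε.one_le_weight i
  obtain ⟨j, l, hl, hjl⟩ := h.exists_eq_smul_of_map_sup ((e i).comp T)
    (fun x y => by simp [hT.map_sup, h.map_sup]) (1 + 1 / 2) (fun x => by
      have h1 := hε.perturbedNorm_le_mul h (δ := 1 / 2) (by norm_num) hε.le_half x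
      rw [← hT.isometry] at h1
      exact ((h.abs_apply_le i (T x)).trans (hε.norm_le_perturbedNorm h (T x))).trans h1) (by
      obtain ⟨y, hy⟩ := h.ne_zero i
      obtain ⟨x, rfl⟩ := hT.surjective y
      exact ⟨x, hy⟩)
  refine ⟨j, fun x => ?_⟩
  have hwj := hε.one_le_weight j
  -- The ratio of two functionals of dual norm one; composing with the surjective isometry `T`
  -- preserves dual norms, so it equals one.
  set κ : ℝ := perturbedWeight e ε i * l / perturbedWeight e ε j with hκ
  have hκ0 : 0 < κ := by positivity
  have hrel : ∀ x, perturbedWeight e ε i * e i (T x) = κ * (perturbedWeight e ε j * e j x) := by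
    intro x
    have := hjl x
    rw [LinearMap.comp_apply] at this
    rw [this, hκ]
    field_simp
  have h1 : κ ≤ 1 := by
    refine le_of_forall_pos_le_add fun η hη => ?_
    obtain ⟨y, hy, hyN⟩ := hε.exists_weight_mul_eq_one h j hη
    have h2 := hε.weight_mul_abs_le h i (T y)
    have h3 := hrel y
    rw [hy, mul_one] at h3
    have h4 := mul_le_mul_of_nonneg_left (le_abs_self (e i (T y))) (by linarith : 0 ≤
      perturbedWeight e ε i)
    rw [hT.isometry] at h2
    linarith
  have h2 : 1 ≤ κ := by
    refine le_of_forall_pos_le_add fun η hη => ?_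
    obtain ⟨y, hy, hyN⟩ := hε.exists_weight_mul_eq_one h i hη
    obtain ⟨z, rfl⟩ := hT.surjective y
    rw [hrel z] at hy
    have h3 := hε.weight_mul_abs_le h j z
    rw [hT.isometry] at hyN
    have h4 := mul_le_mul_of_nonneg_left (le_abs_self (e j z)) (by linarith : 0 ≤
      perturbedWeight e ε j)
    have h5 : κ * (perturbedWeight e ε j * e j z) ≤ κ * (1 + η) :=
      mul_le_mul_of_nonneg_left (by linarith) hκ0.le
    nlinarith
  rw [hrel x, le_antisymm h1 h2, one_mul]

theorem exists_equiv (hε : IsRigidPerturbation C e b ε) (h : IsEvaluationSystem C e)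
    {T : X →ₗ[ℝ] X} (hT : IsLatticeIsometry (perturbedNorm e b ε) T) :
    ∃ φ : I ≃ I, ∀ i x,
      perturbedWeight e ε i * e i (T x) = perturbedWeight e ε (φ i) * e (φ i) x := by
  have hinj : Function.Injective T := by
    rw [injective_iff_map_eq_zero]
    intro x hx
    refine (hε.isLatticeNorm h).definite x ?_
    rw [← hT.isometry, hx, map_zero]
  let S : X ≃ₗ[ℝ] X := LinearEquiv.ofBijective T ⟨hinj, hT.surjective⟩
  have hTS : ∀ x, T (S.symm x) = x := fun x => S.apply_symm_apply x
  have hST : ∀ x, S.symm (T x) = x := fun x => S.symm_apply_apply x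
  have hS : IsLatticeIsometry (perturbedNorm e b ε) S.symm.toLinearMap :=
    { surjective := S.symm.surjective
      isometry := fun x => by
        rw [← hT.isometry]
        simp [hTS]
      map_sup := fun x y => hinj (by simp [hTS, hT.map_sup])
      map_inf := fun x y => hinj (by simp [hTS, hT.map_inf]) }
  obtain ⟨φ, hφ⟩ := hε.exists_index_map h hT
  obtain ⟨ψ, hψ⟩ := hε.exists_index_map h hS
  refine ⟨⟨φ, ψ, fun i => ?_, fun i => ?_⟩, hφ⟩
  · refine (hε.eq_of_weight_mul_eq h (one_ne_zero' ℝ) fun x => ?_).symm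
    rw [one_mul, ← hψ, ← hφ]
    simp [hTS]
  · refine (hε.eq_of_weight_mul_eq h (one_ne_zero' ℝ) fun x => ?_).symm
    rw [one_mul, ← hφ, ← hψ]
    simp [hST]

/-! ### Non-isolated indices -/

/-- If normalized evaluations converge along an ultrafilter away from `i` to a positive multiple of
the normalized evaluation at `i`, then the multiple is `C⁻¹ ^ k / w i` for a natural number `k`. -/
theorem exists_pow_eq_of_tendsto (hε : IsRigidPerturbation C e b ε) (h : IsEvaluationSystem C e)
    {U : Ultrafilter I} {i : I} (hU : ∀ᶠ t in (U : Filter I), t ≠ i) {l : ℝ} (hl : 0 < l)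
    (hlim : ∀ x, Tendsto (fun t => perturbedWeight e ε t * e t x) U
      (𝓝 (l * (perturbedWeight e ε i * e i x)))) :
    ∃ k : ℕ, l * perturbedWeight e ε i = C⁻¹ ^ k := by
  -- The ultrafilter leaves every finite set, so the weights tend to one and can be divided out.
  have hw : Tendsto (perturbedWeight e ε) U (𝓝 1) := hε.tendsto_weight
    (h.eventually_notMem_finite hU (l := l * perturbedWeight e ε i)
      (mul_ne_zero hl.ne' (by linarith [hε.one_le_weight i])) (perturbedWeight e ε)
      fun x => by simpa only [mul_assoc] using hlim x)
  have hlim' : ∀ x, Tendsto (fun t => e t x) U (𝓝 (l * (perturbedWeight e ε i * e i x))) := by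
    intro x
    have := (hlim x).div hw one_ne_zero
    rw [div_one] at this
    refine this.congr fun t => ?_
    have := hε.one_le_weight t
    exact mul_div_cancel_left₀ _ (by linarith)
  have hwi := hε.one_le_weight i
  rcases h.ultrafilter_limit U with h0 | ⟨j, k, hk⟩
  · obtain ⟨x, hx⟩ := h.ne_zero i
    have h1 := tendsto_nhds_unique (h0 x) (hlim' x)
    have h2 : l * (perturbedWeight e ε i * e i x) ≠ 0 :=
      mul_ne_zero hl.ne' (mul_ne_zero (by linarith) hx)
    exact absurd h1.symm h2
  · have heq : ∀ x, l * (perturbedWeight e ε i * e i x) = C⁻¹ ^ k * e j x := fun x =>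
      tendsto_nhds_unique (hlim' x) (hk x)
    have hCk : 0 < C⁻¹ ^ k := pow_pos (inv_pos.2 (zero_lt_one.trans h.one_lt)) k
    have hji : i = j := by
      by_contra hne
      obtain ⟨x, hxj, hxi⟩ := h.exists_ne_zero j i (Ne.symm hne)
      have := heq x
      rw [hxj, mul_zero, mul_zero] at this
      exact mul_ne_zero hCk.ne' hxi this.symm
    subst hji
    obtain ⟨x, hx⟩ := h.ne_zero i
    refine ⟨k, mul_right_cancel₀ hx ?_⟩
    rw [mul_assoc, heq]

/-- Transporting by `φ` an ultrafilter that accumulates at `i` keeps the limit factor `l`. Thus `l *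
(1 + ε i)` and `l * (1 + ε (φ i))` are both powers of `C⁻¹`, and both perturbation factors lie in
`[1, C)`. -/
theorem eps_eq_of_not_isolated [CompleteSpace X] (hε : IsRigidPerturbation C e b ε)
    (h : IsEvaluationSystem C e) {T : X →ₗ[ℝ] X} {φ : I ≃ I} (hφ : ∀ i x,
      perturbedWeight e ε i * e i (T x) = perturbedWeight e ε (φ i) * e (φ i) x)
    {i : I} (hi : ¬ IsIsolatedIndex e i) :
    ¬ IsIsolatedIndex e (φ i) ∧ ε (φ i) = ε i := by
  obtain ⟨U, k, hU, hlim⟩ := h.exists_ultrafilter_of_not_isolated hi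
  have hC0 : 0 < C⁻¹ := inv_pos.2 (zero_lt_one.trans h.one_lt)
  have hwi := hε.one_le_weight i
  have hwj := hε.one_le_weight (φ i)
  have hw : Tendsto (perturbedWeight e ε) U (𝓝 1) := hε.tendsto_weight
    (h.eventually_notMem_finite hU (pow_pos hC0 k).ne' (fun _ => 1)
      fun x => by simpa only [one_mul] using hlim x)
  set l : ℝ := C⁻¹ ^ k / perturbedWeight e ε i with hl
  have hl0 : 0 < l := by positivity
  have hlim' : ∀ x, Tendsto (fun t => perturbedWeight e ε t * e t x) U
      (𝓝 (l * (perturbedWeight e ε i * e i x))) := by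
    intro x
    have h1 := hw.mul (hlim x)
    rwa [one_mul, ← div_mul_cancel₀ (C⁻¹ ^ k) (by linarith : perturbedWeight e ε i ≠ 0),
      mul_assoc] at h1
  have hlimφ : ∀ x, Tendsto (fun t => perturbedWeight e ε t * e t x) (U.map φ : Ultrafilter I)
      (𝓝 (l * (perturbedWeight e ε (φ i) * e (φ i) x))) := by
    intro x
    rw [Ultrafilter.coe_map, tendsto_map'_iff, ← hφ]
    exact (hlim' (T x)).congr fun t => hφ t x
  have hUφ : ∀ᶠ t in ((U.map φ : Ultrafilter I) : Filter I), t ≠ φ i := by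
    rw [Ultrafilter.coe_map, eventually_map]
    exact hU.mono fun t ht => φ.injective.ne ht
  have hnot : ¬ IsIsolatedIndex e (φ i) := by
    rintro ⟨a, ha, ha'⟩
    have h1 := tendsto_nhds_unique (hlimφ a) ((tendsto_const_nhds (x := (0 : ℝ))).congr'
      (hUφ.mono fun t ht => by simp [ha' t ht]))
    rw [ha, mul_one] at h1
    exact (by positivity : l * perturbedWeight e ε (φ i) ≠ 0) h1
  refine ⟨hnot, ?_⟩
  obtain ⟨m, hm⟩ := hε.exists_pow_eq_of_tendsto h hUφ hl0 hlimφ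
  have hi' : l * perturbedWeight e ε i = C⁻¹ ^ k := by
    rw [hl]
    field_simp
  rw [perturbedWeight, if_neg hnot] at hm
  rw [perturbedWeight, if_neg hi] at hi'
  have hC0' : C ≠ 0 := (zero_lt_one.trans h.one_lt).ne'
  have hmul : l * ((1 + ε (φ i)) * C ^ m) = l * ((1 + ε i) * C ^ k) := by
    rw [← mul_assoc, ← mul_assoc, hm, hi', ← mul_pow, ← mul_pow, inv_mul_cancel₀ hC0',
      one_pow, one_pow]
  have := eq_of_mul_pow_eq_mul_pow h.one_lt (by linarith [hε.nonneg (φ i)])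
    (hε.one_add_lt (φ i)) (by linarith [hε.nonneg i]) (hε.one_add_lt i)
    (mul_left_cancel₀ hl0.ne' hmul)
  linarith

/-! ### Isolated indices -/

open Classical in
-- Only when `i` is the base does the coupling add `ε j` to the value two. Otherwise the base
-- coordinate is at most one and the added term at most `1 / 2 * 2`, so the coefficient two keeps
-- the norm at two.
theorem perturbedNorm_two_smul_add (hε : IsRigidPerturbation C e b ε)
    (h : IsEvaluationSystem C e) {i j : I} (hij : i ≠ j) (hi : IsIsolatedIndex e i)
    (hj : IsIsolatedIndex e j) {x : X} (hxi : e i x = 2) (hxj : e j x = 1)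
    (hx : ∀ k, k ≠ i → k ≠ j → e k x = 0) :
    perturbedNorm e b ε x = 2 + if b i = i then ε j else 0 := by
  have hif : 0 ≤ if b i = i then ε j else 0 := by
    split_ifs
    · exact hε.nonneg j
    · exact le_rfl
  have hx2 : ∀ k, |e k x| ≤ 2 := fun k => by
    by_cases hki : k = i
    · rw [hki, hxi, abs_two]
    · by_cases hkj : k = j
      · rw [hkj, hxj, abs_one]
        exact one_le_two
      · rw [hx k hki hkj, abs_zero]
        exact zero_le_two
  obtain ⟨h1, h2⟩ := (hε.perturbedNorm_le_iff h x _).1 le_rfl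
  refine le_antisymm ((hε.perturbedNorm_le_iff h x _).2
    ⟨((h.norm_le_iff _ _ zero_le_two).2 hx2).trans (by linarith), fun k => ?_⟩) ?_
  · have hk0 := hε.nonneg k
    have hk1 := hε.le_half k
    by_cases hk : IsIsolatedIndex e k
    · have hbk := hε.base_eq k i hk hi
      by_cases hbi : b i = i
      · rw [hbk, if_pos hbi, hbi, hxi, abs_two]
        by_cases hki : k = i
        · have h0 := hε.eps_base i hi
          rw [hbi] at h0
          rw [hki, h0, zero_mul]
          linarith [hε.nonneg j]
        · by_cases hkj : k = j
          · rw [hkj, hxj, abs_one, mul_one]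
          · rw [hx k hki hkj, abs_zero, mul_zero]
            linarith [hε.nonneg j]
      · rw [hbk, if_neg hbi]
        have hb1 : |e (b i) x| ≤ 1 := by
          by_cases hbj : b i = j
          · rw [hbj, hxj, abs_one]
          · rw [hx _ hbi hbj, abs_zero]
            exact zero_le_one
        nlinarith [hx2 k]
    · have hki : k ≠ i := by
        rintro rfl
        exact hk hi
      have hkj : k ≠ j := by
        rintro rfl
        exact hk hj
      rw [hε.base_of_not_isolated k hk, hx k hki hkj]
      simp only [abs_zero, mul_zero, add_zero]
      linarith
  · split_ifs with hbi
    · have h3 := h2 j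
      rwa [hε.base_eq j i hj hi, hbi, hxi, hxj, abs_two, abs_one, mul_one] at h3
    · have h3 := (h.abs_apply_le i x).trans h1
      rw [hxi, abs_two] at h3
      linarith

theorem index_eq_of_isolated (hε : IsRigidPerturbation C e b ε)
    (h : IsEvaluationSystem C e) {T : X →ₗ[ℝ] X}
    (hT : IsLatticeIsometry (perturbedNorm e b ε) T) {φ : I ≃ I} (hφ : ∀ i x,
      perturbedWeight e ε i * e i (T x) = perturbedWeight e ε (φ i) * e (φ i) x)
    (hiso : ∀ i, IsIsolatedIndex e i → IsIsolatedIndex e (φ i)) :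
    ∀ i, IsIsolatedIndex e i → φ i = i := by
  have hw : ∀ i, IsIsolatedIndex e i → perturbedWeight e ε i = 1 := fun i hi => if_pos hi
  -- Here `i` is the base. Comparing the norms of `x` and `T x` excludes the case that `φ i` is not
  -- the base, since `ε j > 0`; then `ε (φ j) = ε j` forces `φ j = j`.
  have key : ∀ i j, i ≠ j → IsIsolatedIndex e i → IsIsolatedIndex e j → b i = i →
      φ i = i ∧ φ j = j := by
    intro i j hij hi hj hbi
    have hφij : φ i ≠ φ j := φ.injective.ne hij
    obtain ⟨a, ha, ha'⟩ := hiso i hi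
    obtain ⟨c, hc, hc'⟩ := hiso j hj
    set x : X := (2 : ℝ) • a + c with hx
    have hval : ∀ k, e k x = 2 * e k a + e k c := fun k => by simp [hx]
    have hxi : e (φ i) x = 2 := by rw [hval, ha, hc' _ hφij]; norm_num
    have hxj : e (φ j) x = 1 := by rw [hval, hc, ha' _ hφij.symm]; norm_num
    have hxk : ∀ k, k ≠ φ i → k ≠ φ j → e k x = 0 := fun k h1 h2 => by
      rw [hval, ha' k h1, hc' k h2]; norm_num
    have hTi : ∀ k, IsIsolatedIndex e k → e k (T x) = e (φ k) x := fun k hk => by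
      have := hφ k x
      rwa [hw k hk, hw _ (hiso k hk), one_mul, one_mul] at this
    have hTk : ∀ k, k ≠ i → k ≠ j → e k (T x) = 0 := fun k h1 h2 => by
      have := hφ k x
      rw [hxk _ (φ.injective.ne h1) (φ.injective.ne h2), mul_zero] at this
      refine (mul_eq_zero.1 this).resolve_left ?_
      linarith [hε.one_le_weight k]
    have h1 := hε.perturbedNorm_two_smul_add h hφij (hiso i hi) (hiso j hj) hxi hxj hxk
    have h2 := hε.perturbedNorm_two_smul_add h hij hi hj ((hTi i hi).trans hxi)
      ((hTi j hj).trans hxj) hTk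
    rw [hT.isometry, h1, if_pos hbi, add_right_inj] at h2
    have hbj : b j ≠ j := by
      rw [hε.base_eq j i hj hi, hbi]
      exact hij
    have hpos := hε.pos_of_isolated j hj hbj
    split_ifs at h2 with hb
    · refine ⟨?_, (hε.injective _ _ hpos h2.symm).symm⟩
      rw [← hb, hε.base_eq _ _ (hiso i hi) hi, hbi]
    · exact absurd h2 hpos.ne
  intro i hi
  have hbb : b (b i) = b i := hε.base_eq _ _ (hε.base_isolated i hi) hi
  -- The comparison needs a second isolated index: if the base moved, its image would serve.
  by_cases hbi : b i = i
  · by_cases hφi : φ i = i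
    · exact hφi
    · exact (key i (φ i) (Ne.symm hφi) hi (hiso i hi) hbi).1
  · exact (key (b i) i hbi (hε.base_isolated i hi) hi hbb).2

theorem eq_id [CompleteSpace X] (hε : IsRigidPerturbation C e b ε)
    (h : IsEvaluationSystem C e) {T : X →ₗ[ℝ] X}
    (hT : IsLatticeIsometry (perturbedNorm e b ε) T) : T = LinearMap.id := by
  obtain ⟨φ, hφ⟩ := hε.exists_equiv h hT
  have hiso : ∀ i, IsIsolatedIndex e i → IsIsolatedIndex e (φ i) := by
    rintro i ⟨a, ha, ha'⟩
    obtain ⟨x, rfl⟩ := hT.surjective a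
    have hwi := hε.one_le_weight i
    have hne : e (φ i) x ≠ 0 := by
      intro h0
      have := hφ i x
      rw [ha, h0, mul_one, mul_zero] at this
      linarith
    refine ⟨(e (φ i) x)⁻¹ • x, by simp [hne], fun j hj => ?_⟩
    obtain ⟨k, rfl⟩ := φ.surjective j
    have h1 := hφ k x
    have hwk := hε.one_le_weight (φ k)
    rw [ha' k (fun hk => hj (by rw [hk])), mul_zero] at h1
    have h2 := (mul_eq_zero.1 h1.symm).resolve_left (by linarith)
    rw [map_smul, h2, smul_zero]
  have hfix : ∀ i, IsIsolatedIndex e i ∨ 0 < ε i → φ i = i := by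
    intro i hi
    by_cases hi' : IsIsolatedIndex e i
    · exact hε.index_eq_of_isolated h hT hφ hiso i hi'
    · have heps := (hε.eps_eq_of_not_isolated h hφ hi').2
      exact (hε.injective _ _ (hi.resolve_left hi') heps.symm).symm
  refine LinearMap.ext fun x => ?_
  rw [LinearMap.id_apply, ← sub_eq_zero]
  refine hε.separating _ fun i hi => ?_
  have h1 := hφ i x
  have hwi := hε.one_le_weight i
  rw [hfix i hi] at h1
  rw [map_sub, sub_eq_zero]
  exact mul_left_cancel₀ (by linarith) h1

end IsRigidPerturbation

/-! ### Atoms and conclusion -/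

theorem IsEvaluationSystem.eq_of_hasAtMostOneAtom {X : Type*} [NormedAddCommGroup X]
    [NormedSpace ℝ X] [Lattice X] {I : Type*} {C : ℝ} {e : I → X →ₗ[ℝ] ℝ}
    (h : IsEvaluationSystem C e) (hX : HasAtMostOneAtom X) {i j : I}
    (hi : IsIsolatedIndex e i) (hj : IsIsolatedIndex e j) : i = j := by
  have hatom : ∀ {i : I} {a : X}, e i a = 1 → (∀ j, j ≠ i → e j a = 0) →
      IsLatticeAtom a ∧ ‖a‖ = 1 := by
    intro i a ha ha'
    have ha0 : 0 ≤ a := h.nonneg_iff.2 fun j => by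
      by_cases hj : j = i
      · rw [hj, ha]
        exact zero_le_one
      · rw [ha' j hj]
    refine ⟨⟨lt_of_le_of_ne ha0 ?_, fun x hx hxa => ⟨e i x, h.ext fun j => ?_⟩⟩, ?_⟩
    · rintro rfl
      simp at ha
    · rw [map_smul, smul_eq_mul]
      by_cases hj : j = i
      · rw [hj, ha, mul_one]
      · rw [ha' j hj, mul_zero]
        exact le_antisymm ((h.le_iff.1 hxa j).trans (ha' j hj).le) (h.nonneg_iff.1 hx j)
    · refine le_antisymm ((h.norm_le_iff _ _ zero_le_one).2 fun j => ?_) ?_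
      · by_cases hj : j = i
        · rw [hj, ha, abs_one]
        · rw [ha' j hj, abs_zero]
          exact zero_le_one
      · simpa [ha] using h.abs_apply_le i a
  obtain ⟨a, ha, ha'⟩ := hi
  obtain ⟨c, hc, hc'⟩ := hj
  by_contra hij
  have hac := hX a c (hatom ha ha').1 (hatom hc hc').1 (hatom ha ha').2 (hatom hc hc').2
  have := hc' i hij
  rw [← hac, ha] at this
  exact one_ne_zero this

theorem theorem3p1 (X : Type u) [NormedAddCommGroup X] [NormedSpace ℝ X] [Lattice X]
    [IsOrderedAddMonoid X] [IsOrderedModule ℝ X] [HasSolidNorm X] [CompleteSpace X]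
    [SeparableSpace X] (C : ℝ) (hX : IsBenyaminiSpace.{u, v} C X) (c : ℝ) (hc : 1 < c) :
    ∃ N : Seminorm ℝ X,
      IsLatticeNorm N ∧
      (∀ x : X, ‖x‖ ≤ N x ∧ N x ≤ c ^ 2 * ‖x‖) ∧
      (∀ T : X →ₗ[ℝ] X, IsLatticeIsometry N T → T = LinearMap.id) ∧
      (HasAtMostOneAtom X → IsAMNorm N) := by
  obtain ⟨I, e, h⟩ := hX.exists_isEvaluationSystem
  -- Perturbations up to `c ^ 2 - 1` use the full allowance, as the norm grows by at most `1 + δ`.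
  have hδ : 0 < c ^ 2 - 1 := by nlinarith
  obtain ⟨b, ε, hε, hεδ⟩ := h.exists_isRigidPerturbation hδ
  refine ⟨perturbedNorm e b ε, hε.isLatticeNorm h, fun x => ⟨hε.norm_le_perturbedNorm h x, ?_⟩,
    fun T hT => hε.eq_id h hT,
    fun hA => hε.isAMNorm h fun i j hi hj => h.eq_of_hasAtMostOneAtom hA hi hj⟩
  have := hε.perturbedNorm_le_mul h hδ.le hεδ x
  rwa [add_sub_cancel] at this
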